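/- Let $N$ be a smooth $n$-dimensional manifold with a smooth Riemannian metric $h$, and let $W$ be a smooth vector field on $N$ with $\|W\|_h<1$ that is homothetic with dilation $k_0\in\mathbb R$, that is, $\mathcal L_W h=-4k_0h$ (equivalently $\tfrac12(w_{i|j}+w_{j|i})=-2k_0h_{ij}$, where $w_i=h_{ij}w^j$). Let $$F(y)=\frac{\sqrt{\lambda\, h(y,y)+h(W,y)^2}-h(W,y)}{\lambda},\qquad \lambda=1-\|W\|_h^2,$$ be the Randers metric with navigation datum $(h,W)$ and $d\mu_{BH}$ its Busemann--Hausdorff volume form. For a Finsler metric $F$ with volume form $d\mu=\sigma\,dx^1\wedge\dots\wedge dx^n$ and a function $f$, let $N_f=\{x: df(x)\ne0\}$ and $J=f(N_f)$, let $\nabla f=\mathcal L^{-1}(df)$, where $\mathcal L(y)=F(y)F_{y^i}(y)\,dx^i$ (and $\mathcal L(0)=0$) is the Legendre transformation, and let $\Delta f=\mathrm{div}_\sigma(\nabla f)$. A non-constant $C^1$ function $f$ that is smooth on $N_f$ is called isoparametric for $(N,F,d\mu)$ if there are a smooth function $\tilde a$ and a continuous function $\tilde b$ on $J$ with $F(\nabla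 f)=\tilde a(f)$ and $\Delta f=\tilde b(f)$ on $N_f$. For $(N,h)$ this is understood with the norm and the volume form of $h$. **Theorem.** Let $f$ be an isoparametric function of $(N,h)$, with $\|\nabla^hf\|_h=a(f)$ and $\Delta^hf=b(f)$ on $N_f$. Then $f$ is an isoparametric function of $(N,F,d\mu_{BH})$ if and only if there is a smooth function $\varphi:J\to\mathbb R$ such that $df(W)=\varphi(f)$ on $N_f$. In that case the functions $\tilde a,\tilde b$ of $f$ with respect to $(N,F,d\mu_{BH})$ are, on $J$, $$\tilde a=a+\varphi,\qquad \tilde b=(a+\varphi)\left(\frac{b}{a}-2nk_0+\varphi'\right).$$ -/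

import Mathlib

open scoped Manifold ContDiff

noncomputable section

namespace Randers

/-- The Euclidean space `ℝⁿ`, on which `n`-dimensional manifolds are modelled. -/
abbrev Model (n : ℕ) : Type := EuclideanSpace ℝ (Fin n)

section Manifold

variable {n : ℕ} {N : Type*} [TopologicalSpace N] [ChartedSpace (Model n) N]

/-! ### Local coordinates -/

section Coordinates

variable [IsManifold (𝓡 n) ∞ N]

/-- The vector `∑ vⁱ ∂/∂xⁱ` of `T_p N`, where `(xⁱ)` are the coordinates of the chart at `c`.
(The trivialization of the tangent bundle at `c` is, on the fibre over `p`, the differential of the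
chart at `c`, and `symmL` is its inverse.) -/
def ofCoord (c p : N) (v : Model n) : TangentSpace (𝓡 n) p :=
  (trivializationAt (Model n) (TangentSpace (𝓡 n)) c).symmL ℝ p v

/-- The coordinate vector field `∂/∂xⁱ` at `p`, in the chart at `c`. -/
def coordVec (c p : N) (i : Fin n) : TangentSpace (𝓡 n) p :=
  ofCoord c p (EuclideanSpace.single i 1)

/-- The components `Xⁱ`, in the chart at `c`, of a tangent vector `X = ∑ Xⁱ ∂/∂xⁱ` at `p`. -/
def comps (c p : N) (X : TangentSpace (𝓡 n) p) : Model n :=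
  (trivializationAt (Model n) (TangentSpace (𝓡 n)) c).continuousLinearMapAt ℝ p X

end Coordinates

/-- The partial derivative `∂q/∂xⁱ` at the point `c`, in the chart at `c`. -/
def partialAt (c : N) (i : Fin n) (q : N → ℝ) : ℝ :=
  fderiv ℝ (fun u : Model n => q ((extChartAt (𝓡 n) c).symm u)) (extChartAt (𝓡 n) c c)
    (EuclideanSpace.single i 1)

/-! ### Legendre transformation, gradient, Laplacian

Here `F : TN → ℝ` is a Finsler metric, given as a family of functions on the tangent spaces. -/

/-- The Legendre transformation `y ↦ F(y) F_{yⁱ}(y) dxⁱ` (with value `0` at `y = 0`,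
where `F` vanishes). -/
def legendre (F : (x : N) → TangentSpace (𝓡 n) x → ℝ) (x : N) (y : TangentSpace (𝓡 n) x) :
    TangentSpace (𝓡 n) x →L[ℝ] ℝ :=
  F x y • fderiv ℝ (F x) y

/-- The differential `df(x) ∈ T*_x N`. -/
def diff (f : N → ℝ) (x : N) : TangentSpace (𝓡 n) x →L[ℝ] ℝ :=
  mfderiv (𝓡 n) 𝓘(ℝ, ℝ) f x

/-- The (nonlinear) gradient `∇f(x) = 𝓛⁻¹(df(x))`. -/
def gradient (F : (x : N) → TangentSpace (𝓡 n) x → ℝ) (f : N → ℝ) (x : N) :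
    TangentSpace (𝓡 n) x :=
  Function.invFun (legendre F x) (diff f x)

section Laplacian

variable [IsManifold (𝓡 n) ∞ N]

/-- The divergence `σ⁻¹ ∂/∂xⁱ (σ Xⁱ)` at `x`, computed in the chart at `x`. A volume form (or
density) is given by its coefficients: `σ c p` is its coefficient `σ` at `p` with respect to
`dx¹ ⋯ dxⁿ`, in the chart at `c`. -/
def divergence (σ : N → N → ℝ) (X : (x : N) → TangentSpace (𝓡 n) x) (x : N) : ℝ :=
  (σ x x)⁻¹ * ∑ i : Fin n, partialAt x i (fun p => σ x p * comps x p (X p) i)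

/-- The Finsler Laplacian `Δf = div_σ(∇f)`. -/
def laplacian (F : (x : N) → TangentSpace (𝓡 n) x → ℝ) (σ : N → N → ℝ) (f : N → ℝ) (x : N) : ℝ :=
  divergence σ (gradient F f) x

/-- The Busemann–Hausdorff volume form of `F`: its coefficient at `p` is
`vol(𝔹ⁿ) / vol {v ∈ ℝⁿ | F(p, ∑ vⁱ ∂/∂xⁱ) < 1}`. -/
def volBH (F : (x : N) → TangentSpace (𝓡 n) x → ℝ) (c p : N) : ℝ :=
  MeasureTheory.volume.real (Metric.ball (0 : Model n) 1) /
    MeasureTheory.volume.real {v : Model n | F p (ofCoord c p v) < 1}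

end Laplacian

/-! ### Isoparametric functions -/

/-- The set `N_f` of points where `df ≠ 0`. -/
def regularSet (n : ℕ) {N : Type*} [TopologicalSpace N] [ChartedSpace (Model n) N] (f : N → ℝ) :
    Set N :=
  {x | diff (n := n) f x ≠ 0}

/-- The set `J = f(N_f)`. -/
def regularValues (n : ℕ) {N : Type*} [TopologicalSpace N] [ChartedSpace (Model n) N] (f : N → ℝ) :
    Set ℝ :=
  f '' regularSet n f

variable [IsManifold (𝓡 n) ∞ N]

/-- `f` is an isoparametric function of `(N, F, σ)`, with functions `a` and `b`: `f` is
non-constant, `C¹`, and smooth on `N_f`; `a` is smooth and `b` is continuous on `J = f(N_f)`; and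
`F(∇f) = a(f)` and `Δf = b(f)` hold on `N_f`. -/
structure IsIsoparametricWith (F : (x : N) → TangentSpace (𝓡 n) x → ℝ) (σ : N → N → ℝ)
    (f : N → ℝ) (a b : ℝ → ℝ) : Prop where
  nonconstant : ∃ x y, f x ≠ f y
  contMDiff : ContMDiff (𝓡 n) 𝓘(ℝ, ℝ) 1 f
  smoothOn : ContMDiffOn (𝓡 n) 𝓘(ℝ, ℝ) ∞ f (regularSet n f)
  smooth_a : ContDiffOn ℝ ∞ a (regularValues n f)
  continuous_b : ContinuousOn b (regularValues n f)
  norm_gradient : ∀ x ∈ regularSet n f, F x (gradient F f x) = a (f x)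
  laplacian_eq : ∀ x ∈ regularSet n f, laplacian F σ f x = b (f x)

/-- `f` is an isoparametric function of `(N, F, σ)`. -/
def IsIsoparametric (F : (x : N) → TangentSpace (𝓡 n) x → ℝ) (σ : N → N → ℝ) (f : N → ℝ) : Prop :=
  ∃ a b : ℝ → ℝ, IsIsoparametricWith F σ f a b

/-! ### Riemannian metrics, homothetic vector fields and Randers metrics -/

/-- Smooth Riemannian metrics on `N`. -/
abbrev RiemMetric (n : ℕ) (N : Type*) [TopologicalSpace N] [ChartedSpace (Model n) N]
    [IsManifold (𝓡 n) ∞ N] :=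
  Bundle.ContMDiffRiemannianMetric (𝓡 n) ∞ (Model n) (fun x : N => TangentSpace (𝓡 n) x)

/-- A Riemannian metric as a Finsler metric: `y ↦ √(h(y, y))`. -/
def riemNorm (h : RiemMetric n N) (x : N) (y : TangentSpace (𝓡 n) x) : ℝ :=
  √(h.inner x y y)

/-- The coefficients `h_{ij}` at `p`, in the chart at `c`. -/
def metricCoeff (h : RiemMetric n N) (c p : N) : Matrix (Fin n) (Fin n) ℝ :=
  fun i j => h.inner p (coordVec c p i) (coordVec c p j)

/-- The Riemannian volume form `√(det h_{ij}) dx¹ ⋯ dxⁿ`. -/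
def riemVol (h : RiemMetric n N) (c p : N) : ℝ :=
  √((metricCoeff h c p).det)

/-- The components `(L_W h)_{ij} = Wᵏ ∂ₖ h_{ij} + h_{kj} ∂ᵢ Wᵏ + h_{ik} ∂ⱼ Wᵏ` at `x` of the Lie
derivative of `h` along `W`, in the chart at `x`. In terms of the Levi-Civita connection of `h`,
this is `w_{i|j} + w_{j|i}`. -/
def lieDerivMetric (h : RiemMetric n N) (W : (x : N) → TangentSpace (𝓡 n) x) (x : N)
    (i j : Fin n) : ℝ :=
  ∑ k : Fin n,
    (comps x x (W x) k * partialAt x k (fun p => metricCoeff h x p i j)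
      + metricCoeff h x x k j * partialAt x i (fun p => comps x p (W p) k)
      + metricCoeff h x x i k * partialAt x j (fun p => comps x p (W p) k))

/-- `W` is a homothetic vector field of `(N, h)` with dilation `k₀`: `L_W h = -4 k₀ h`, that is,
`(w_{i|j} + w_{j|i}) / 2 = -2 k₀ h_{ij}`. -/
def IsHomothetic (h : RiemMetric n N) (W : (x : N) → TangentSpace (𝓡 n) x) (k₀ : ℝ) : Prop :=
  ∀ (x : N) (i j : Fin n), lieDerivMetric h W x i j = -4 * k₀ * metricCoeff h x x i j

/-- The Randers metric with navigation datum `(h, W)`: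
`F(y) = (√(λ h(y, y) + h(W, y)²) - h(W, y)) / λ` with `λ = 1 - h(W, W)`. -/
def randersMetric (h : RiemMetric n N) (W : (x : N) → TangentSpace (𝓡 n) x) (x : N)
    (y : TangentSpace (𝓡 n) x) : ℝ :=
  (√((1 - h.inner x (W x) (W x)) * h.inner x y y + h.inner x (W x) y ^ 2) - h.inner x (W x) y) /
    (1 - h.inner x (W x) (W x))

end Manifold

end Randers

end

/-! In each tangent space the unit ball of F is the h-unit ball translated by W. This has two
consequences.

Duality: with ‖·‖ the h-norm, the norm dual to F is ξ ↦ ‖ξ‖ + ξ(W). Hence on N_f, F(∇f) = ‖∇ʰf‖ +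
df(W) and ∇f = (‖∇ʰf‖ + df(W)) (∇ʰf/‖∇ʰf‖ + W) (`randersMetric_gradient_eq`,
`gradient_randersMetric_eq`). When ‖∇ʰf‖ = a(f), the quantity F(∇f) is thus a smooth function of f
exactly when df(W) is.

Volume: Lebesgue measure is translation invariant, so the Busemann–Hausdorff form is the Riemannian
one (`volBH_randersMetric`).

If df(W) = φ(f), then ∇f = ((a+φ)/a)(f) ∇ʰf + (a+φ)(f) W. Tracing the homothety equation gives div W
= -2nk₀ (`divergence_homothetic`), and the Leibniz rule gives the formula for Δf
(`laplacian_randersMetric`). So the Laplacian condition is automatic once the norm condition holds.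
-/

namespace Randers

/-! ### Navigation norms on one vector space -/

section Fibre

variable {E : Type*} [NormedAddCommGroup E] [NormedSpace ℝ E]

/-- The Minkowski norm with navigation datum `(B, w)` on a single vector space. -/
noncomputable def navNorm (B : E →L[ℝ] E →L[ℝ] ℝ) (w y : E) : ℝ :=
  (√((1 - B w w) * B y y + B w y ^ 2) - B w y) / (1 - B w w)

variable {B : E →L[ℝ] E →L[ℝ] ℝ} {w : E}

theorem bilin_cauchy_schwarz (hs : ∀ v v', B v v' = B v' v) (hp : ∀ v, v ≠ 0 → 0 < B v v)
    (v v' : E) : B v v' ^ 2 ≤ B v v * B v' v' := by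
  by_cases hv : v = 0
  · simp [hv]
  have h0 : 0 ≤ B (B v v • v' - B v v' • v) (B v v • v' - B v v' • v) := by
    by_cases h : B v v • v' - B v v' • v = 0
    · simp [h]
    · exact (hp _ h).le
  have h1 : B (B v v • v' - B v v' • v) (B v v • v' - B v v' • v)
      = B v v * (B v v * B v' v' - B v v' ^ 2) := by
    simp only [map_sub, map_smul, sub_apply, smul_apply,
      smul_eq_mul, hs v' v]
    ring
  rw [h1] at h0
  linarith [nonneg_of_mul_nonneg_right h0 (hp v hv)]

/-- F is the positive root of λF² + 2B(w,y)F = B(y,y), which is the expanded form of |y - F w| = F;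
the square root in its formula is half the derivative of the quadratic at that root. -/
theorem navNorm_spec (hp : ∀ v, v ≠ 0 → 0 < B v v) (hw : B w w < 1) {y : E} (hy : y ≠ 0) :
    0 < navNorm B w y ∧
    √((1 - B w w) * B y y + B w y ^ 2) = (1 - B w w) * navNorm B w y + B w y ∧
    0 < √((1 - B w w) * B y y + B w y ^ 2) ∧
    (1 - B w w) * navNorm B w y ^ 2 + 2 * B w y * navNorm B w y = B y y := by
  have hl : 0 < 1 - B w w := by linarith
  have hq := hp y hy
  have hlq := mul_pos hl hq
  have hpos : 0 < (1 - B w w) * B y y + B w y ^ 2 := by positivity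
  have hD : √((1 - B w w) * B y y + B w y ^ 2) = (1 - B w w) * navNorm B w y + B w y := by
    unfold navNorm; field_simp; ring
  refine ⟨?_, hD, Real.sqrt_pos.2 hpos, ?_⟩
  · refine div_pos (sub_pos.2 ?_) hl
    refine lt_of_le_of_lt (le_abs_self _) ?_
    rw [← Real.sqrt_sq_eq_abs]
    exact Real.sqrt_lt_sqrt (sq_nonneg _) (by linarith)
  · have h2 := Real.sq_sqrt hpos.le
    rw [hD] at h2
    have : (1 - B w w) * ((1 - B w w) * navNorm B w y ^ 2 + 2 * B w y * navNorm B w y)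
      = (1 - B w w) * B y y := by linarith
    exact mul_left_cancel₀ hl.ne' this

theorem navNorm_eq_of_sq (hs : ∀ v v', B v v' = B v' v) (hp : ∀ v, v ≠ 0 → 0 < B v v)
    (hw : B w w < 1) {y : E} {s : ℝ} (h0 : 0 < s)
    (h : B (y - s • w) (y - s • w) = s ^ 2) : navNorm B w y = s := by
  have hl : 0 < 1 - B w w := by linarith
  have hq : 0 ≤ B y y := by
    by_cases hy : y = 0
    · simp [hy]
    · exact (hp _ hy).le
  simp only [map_sub, map_smul, sub_apply, smul_apply,
      smul_eq_mul, hs y w] at h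
  -- `h` says s(λs + 2B(w,y)) = B(y,y) ≥ 0. This fixes the sign of λs + B(w,y), hence the branch of
  -- the square root.
  have h1 : 0 ≤ (1 - B w w) * s + 2 * B w y := by
    refine nonneg_of_mul_nonneg_left (b := s) ?_ h0
    linarith
  have h2 : 0 ≤ (1 - B w w) * s + B w y := by
    have := mul_pos hl h0
    linarith
  have h3 : (1 - B w w) * B y y + B w y ^ 2 = ((1 - B w w) * s + B w y) ^ 2 := by
    have : B y y = (1 - B w w) * s ^ 2 + 2 * B w y * s := by linarith
    rw [this]; ring
  unfold navNorm
  rw [h3, Real.sqrt_sq h2]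
  field_simp
  ring

theorem navNorm_lt_one_iff (hs : ∀ v v', B v v' = B v' v) (hp : ∀ v, v ≠ 0 → 0 < B v v)
    (hw : B w w < 1) (y : E) : navNorm B w y < 1 ↔ B (y - w) (y - w) < 1 := by
  have hl : 0 < 1 - B w w := by linarith
  have hq : 0 ≤ B y y := by
    by_cases hy : y = 0
    · simp [hy]
    · exact (hp _ hy).le
  unfold navNorm
  rw [div_lt_one hl, sub_lt_iff_lt_add]
  simp only [map_sub, sub_apply, hs y w]
  constructor
  · intro h
    have hpos : 0 < 1 - B w w + B w y := lt_of_le_of_lt (Real.sqrt_nonneg _) h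
    rw [Real.sqrt_lt' hpos] at h
    -- After squaring, the difference of the two sides factors as λ(1 - |y - w|²).
    have : 0 < (1 - B w w) * (1 - B w w + 2 * B w y - B y y) := by linarith
    have := pos_of_mul_pos_right this hl.le
    linarith
  · intro h
    have hpos : 0 < 1 - B w w + B w y := by linarith
    rw [Real.sqrt_lt' hpos]
    have : 0 < (1 - B w w) * (1 - B w w + 2 * B w y - B y y) := mul_pos hl (by linarith)
    linarith

/-- The value agrees with implicit differentiation of λF² + 2B(w,y)F = B(y,y). -/
theorem hasFDerivAt_navNorm (hs : ∀ v v', B v v' = B v' v) (hp : ∀ v, v ≠ 0 → 0 < B v v)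
    (hw : B w w < 1) {y : E} (hy : y ≠ 0) :
    HasFDerivAt (navNorm B w)
      ((√((1 - B w w) * B y y + B w y ^ 2))⁻¹ • B (y - navNorm B w y • w)) y := by
  obtain ⟨-, hD, hpos, -⟩ := navNorm_spec hp hw hy
  have hl : 0 < 1 - B w w := by linarith
  have h1 : HasFDerivAt (fun y => B y y) ((2 : ℝ) • B y) y := by
    have := B.hasFDerivAt (x := y) |>.clm_apply (hasFDerivAt_id y)
    refine this.congr_fderiv ?_
    ext v
    simp [hs v y, two_mul]
  have h2 : HasFDerivAt (fun y => B w y) (B w) y := (B w).hasFDerivAt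
  have h3 := ((((h1.const_mul (1 - B w w)).add (h2.pow 2)).sqrt
    (Real.sqrt_ne_zero'.1 hpos.ne' |>.ne')).sub h2).mul_const (1 - B w w)⁻¹
  refine (h3.congr_fderiv ?_)
  ext v
  simp only [smul_apply, sub_apply,
    add_apply, smul_eq_mul, map_sub, map_smul]
  simp only [Pi.add_apply]
  have hne := hpos.ne'
  have hF : navNorm B w y = (√((1 - B w w) * B y y + B w y ^ 2) - B w y) / (1 - B w w) := rfl
  rw [hF]
  field_simp
  simp
  ring

/-- The value of the Legendre transformation of `navNorm B w`. -/
theorem legendre_navNorm (hs : ∀ v v', B v v' = B v' v) (hp : ∀ v, v ≠ 0 → 0 < B v v)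
    (hw : B w w < 1) {y : E} (hy : y ≠ 0) :
    navNorm B w y • fderiv ℝ (navNorm B w) y =
      (navNorm B w y / √((1 - B w w) * B y y + B w y ^ 2)) • B (y - navNorm B w y • w) := by
  rw [(hasFDerivAt_navNorm hs hp hw hy).fderiv, smul_smul, div_eq_mul_inv]

theorem dual_navNorm_pos (hs : ∀ v v', B v v' = B v' v) (hp : ∀ v, v ≠ 0 → 0 < B v v)
    (hw : B w w < 1) {X : E} (hX : X ≠ 0) : 0 < √(B X X) + B X w := by
  have h1 := bilin_cauchy_schwarz hs hp X w
  have h2 := hp X hX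
  have h3 : B X w ^ 2 < B X X := by nlinarith
  have := Real.sqrt_lt_sqrt (sq_nonneg _) h3
  rw [Real.sqrt_sq_eq_abs] at this
  linarith [neg_abs_le (B X w)]

/-- X/|X| + w is a unit vector translated by w, so it lies on the unit sphere of F; the rest is
positive scaling. -/
theorem navNorm_dual (hs : ∀ v v', B v v' = B v' v) (hp : ∀ v, v ≠ 0 → 0 < B v v)
    (hw : B w w < 1) {X : E} (hX : X ≠ 0) :
    navNorm B w ((√(B X X) + B X w) • ((√(B X X))⁻¹ • X + w)) = √(B X X) + B X w := by
  have hg := dual_navNorm_pos hs hp hw hX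
  have hq := hp X hX
  refine navNorm_eq_of_sq hs hp hw hg ?_
  have : (√(B X X) + B X w) • ((√(B X X))⁻¹ • X + w) - (√(B X X) + B X w) • w
    = ((√(B X X) + B X w) * (√(B X X))⁻¹) • X := by
    rw [smul_add, add_sub_cancel_right, smul_smul]
  rw [this]
  simp only [map_smul, smul_apply, smul_eq_mul]
  have h2 : √(B X X) ≠ 0 := (Real.sqrt_pos.2 hq).ne'
  have h3 := Real.sq_sqrt hq.le
  field_simp
  rw [h3]

theorem legendre_navNorm_dual (hs : ∀ v v', B v v' = B v' v) (hp : ∀ v, v ≠ 0 → 0 < B v v)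
    (hw : B w w < 1) {X y : E} (hX : X ≠ 0)
    (hy : y = (√(B X X) + B X w) • ((√(B X X))⁻¹ • X + w)) :
    navNorm B w y • fderiv ℝ (navNorm B w) y = B X := by
  have hg := dual_navNorm_pos hs hp hw hX
  have hF := navNorm_dual hs hp hw hX
  rw [← hy] at hF
  have hq := hp X hX
  have hα : √(B X X) ≠ 0 := (Real.sqrt_pos.2 hq).ne'
  have hy0 : y ≠ 0 := by
    rintro rfl
    rw [show navNorm B w 0 = 0 by simp [navNorm]] at hF
    exact hg.ne hF
  rw [legendre_navNorm hs hp hw hy0, (navNorm_spec hp hw hy0).2.1, hF]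
  have hwy : B w y = (√(B X X) + B X w) * ((√(B X X))⁻¹ * B X w + B w w) := by
    rw [hy]; simp [hs w X]; ring
  have hy2 : y - (√(B X X) + B X w) • w = ((√(B X X) + B X w) * (√(B X X))⁻¹) • X := by
    rw [hy, smul_add, add_sub_cancel_right, smul_smul]
  have hD : (1 - B w w) * (√(B X X) + B X w) + B w y = (√(B X X) + B X w) ^ 2 / √(B X X) := by
    rw [hwy]; field_simp; ring
  rw [hy2, hD, map_smul, smul_smul]
  have : (√(B X X) + B X w) / ((√(B X X) + B X w) ^ 2 / √(B X X)) *
      ((√(B X X) + B X w) * (√(B X X))⁻¹) = 1 := by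
    have := hg.ne'
    field_simp
  rw [this, one_smul]

/-- Nondegeneracy of B turns the hypothesis into X = (F/D)(y - F w), where D is the square root. As
|y - F w| = F, this gives |X| = F²/D and |X| + B(X,w) = F, and y can be solved for. -/
theorem eq_of_legendre_navNorm (hs : ∀ v v', B v v' = B v' v) (hp : ∀ v, v ≠ 0 → 0 < B v v)
    (hw : B w w < 1) {X y : E} (hX : X ≠ 0)
    (h : navNorm B w y • fderiv ℝ (navNorm B w) y = B X) :
    y = (√(B X X) + B X w) • ((√(B X X))⁻¹ • X + w) := by
  have hinj : ∀ v v', B v = B v' → v = v' := by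
    intro v v' hv
    by_contra hne
    have := hp (v - v') (sub_ne_zero.2 hne)
    rw [map_sub B, hv, sub_self] at this
    simp at this
  -- At the origin the factor `navNorm B w 0` is zero, so the covector vanishes whatever `fderiv` is
  -- there.
  have hy0 : y ≠ 0 := by
    rintro rfl
    rw [show navNorm B w 0 = 0 by simp [navNorm], zero_smul, ← map_zero B] at h
    exact hX (hinj _ _ h.symm)
  obtain ⟨hF, hD, hDpos, hquad⟩ := navNorm_spec hp hw hy0
  rw [legendre_navNorm hs hp hw hy0, ← map_smul] at h
  have hX' := hinj _ _ h
  set D := √((1 - B w w) * B y y + B w y ^ 2)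
  set F := navNorm B w y
  have hXX : B X X = (F ^ 2 / D) ^ 2 := by
    rw [← hX']
    simp only [map_sub, map_smul, sub_apply, smul_apply,
      smul_eq_mul, hs y w, ← hquad]
    field_simp
    ring
  have hα : √(B X X) = F ^ 2 / D := by rw [hXX, Real.sqrt_sq (by positivity)]
  have hXw : B X w = F / D * (B w y - F * B w w) := by
    rw [← hX']
    simp only [map_sub, map_smul, sub_apply, smul_apply,
      smul_eq_mul, hs y w]
  have hsum : √(B X X) + B X w = F := by
    rw [hα, hXw]
    have : F ^ 2 / D + F / D * (B w y - F * B w w) = F / D * ((1 - B w w) * F + B w y) := by ring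
    rw [this, ← hD]
    field_simp
  rw [hsum, hα, ← hX', smul_smul, smul_add, smul_smul]
  have : F * ((F ^ 2 / D)⁻¹ * (F / D)) = 1 := by field_simp
  rw [this, one_smul, sub_add_cancel]

theorem exists_bilin_eq [FiniteDimensional ℝ E] (hp : ∀ v, v ≠ 0 → 0 < B v v) (ξ : E →L[ℝ] ℝ) :
    ∃ X, B X = ξ := by
  let L : E →ₗ[ℝ] Module.Dual ℝ E :=
    { toFun := fun v => (B v : E →ₗ[ℝ] ℝ)
      map_add' := by intros; ext; simp
      map_smul' := by intros; ext; simp }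
  have hL : Function.Injective L := by
    rw [← LinearMap.ker_eq_bot, LinearMap.ker_eq_bot']
    intro v hv
    by_contra hne
    have h1 : B v v = 0 := LinearMap.congr_fun hv v
    exact (hp v hne).ne' h1
  obtain ⟨X, hX⟩ := (LinearMap.injective_iff_surjective_of_finrank_eq_finrank
    (Subspace.dual_finrank_eq (K := ℝ) (V := E)).symm).1 hL ξ
  exact ⟨X, ContinuousLinearMap.ext fun v => LinearMap.congr_fun hX v⟩

end Fibre

/-! ### Gradients of Randers metrics -/

section Gradient

variable {n : ℕ} {N : Type*} [TopologicalSpace N] [ChartedSpace (Model n) N]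
  [IsManifold (𝓡 n) ∞ N]

/-- Lets the Riemannian gradient be read off from the Randers formulas with zero wind. -/
theorem randersMetric_zero (h : RiemMetric n N) :
    randersMetric h (fun _ => 0) = riemNorm h := by
  funext x y
  simp [randersMetric, riemNorm]

theorem exists_inner_eq (h : RiemMetric n N) (x : N) (ξ : TangentSpace (𝓡 n) x →L[ℝ] ℝ) :
    ∃ X, h.inner x X = ξ :=
  exists_bilin_eq (E := Model n) (B := h.inner x) (h.pos x) ξ

/-- `gradient` is a `Function.invFun`: a preimage must exist for it to invert the Legendre map at
df, and uniqueness then identifies the value. -/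
theorem gradient_randersMetric (h : RiemMetric n N) {W : (x : N) → TangentSpace (𝓡 n) x}
    {f : N → ℝ} {x : N} (hW : h.inner x (W x) (W x) < 1) {X : TangentSpace (𝓡 n) x} (hX : X ≠ 0)
    (hXf : h.inner x X = diff f x) :
    gradient (randersMetric h W) f x =
      (√(h.inner x X X) + h.inner x X (W x)) • ((√(h.inner x X X))⁻¹ • X + W x) := by
  have hex : ∃ y, legendre (randersMetric h W) x y = diff f x :=
    ⟨_, (legendre_navNorm_dual (E := Model n) (B := h.inner x) (h.symm x) (h.pos x) hW hX
      rfl).trans hXf⟩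
  have := Function.invFun_eq hex
  exact eq_of_legendre_navNorm (E := Model n) (B := h.inner x) (h.symm x) (h.pos x) hW hX
    (this.trans hXf.symm)

theorem randersMetric_gradient (h : RiemMetric n N) {W : (x : N) → TangentSpace (𝓡 n) x}
    {f : N → ℝ} {x : N} (hW : h.inner x (W x) (W x) < 1) {X : TangentSpace (𝓡 n) x} (hX : X ≠ 0)
    (hXf : h.inner x X = diff f x) :
    randersMetric h W x (gradient (randersMetric h W) f x) =
      √(h.inner x X X) + h.inner x X (W x) := by
  rw [gradient_randersMetric h hW hX hXf]
  exact navNorm_dual (E := Model n) (B := h.inner x) (h.symm x) (h.pos x) hW hX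

theorem inner_gradient_riemNorm (h : RiemMetric n N) {f : N → ℝ} {x : N}
    (hx : diff (n := n) f x ≠ 0) : h.inner x (gradient (riemNorm h) f x) = diff f x := by
  obtain ⟨X, hXf⟩ := exists_inner_eq h x (diff f x)
  have hX : X ≠ 0 := by
    rintro rfl
    exact hx (by rw [← hXf, map_zero])
  have h0 := h.pos x X hX
  rw [← randersMetric_zero, gradient_randersMetric h (W := fun _ => 0) (by simp) hX hXf]
  simp only [map_zero, add_zero]
  rw [smul_smul, mul_inv_cancel₀ (Real.sqrt_pos.2 h0).ne', one_smul, hXf]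

/-- The gradient of a Randers metric in terms of the gradient of its navigation datum. -/
theorem gradient_randersMetric_eq (h : RiemMetric n N) {W : (x : N) → TangentSpace (𝓡 n) x}
    {f : N → ℝ} {x : N} (hW : h.inner x (W x) (W x) < 1) (hx : diff (n := n) f x ≠ 0) :
    gradient (randersMetric h W) f x =
      (riemNorm h x (gradient (riemNorm h) f x) + diff (n := n) f x (W x)) •
        ((riemNorm h x (gradient (riemNorm h) f x))⁻¹ • gradient (riemNorm h) f x + W x) := by
  have hX := inner_gradient_riemNorm h hx
  rw [gradient_randersMetric h hW ?_ hX, riemNorm, hX]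
  intro h0
  rw [h0, map_zero] at hX
  exact hx hX.symm

theorem randersMetric_gradient_eq (h : RiemMetric n N) {W : (x : N) → TangentSpace (𝓡 n) x}
    {f : N → ℝ} {x : N} (hW : h.inner x (W x) (W x) < 1) (hx : diff (n := n) f x ≠ 0) :
    randersMetric h W x (gradient (randersMetric h W) f x) =
      riemNorm h x (gradient (riemNorm h) f x) + diff (n := n) f x (W x) := by
  have hX := inner_gradient_riemNorm h hx
  rw [randersMetric_gradient h hW ?_ hX, riemNorm, hX]
  intro h0
  rw [h0, map_zero] at hX
  exact hx hX.symm

theorem riemNorm_gradient_pos (h : RiemMetric n N) {f : N → ℝ} {x : N} (hx : diff (n := n) f x ≠ 0) :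
    0 < riemNorm h x (gradient (riemNorm h) f x) := by
  have hX := inner_gradient_riemNorm h hx
  refine Real.sqrt_pos.2 (h.pos x _ ?_)
  intro h0
  rw [h0, map_zero] at hX
  exact hx hX.symm

theorem diff_gradient_riemNorm (h : RiemMetric n N) {f : N → ℝ} {x : N} (hx : diff (n := n) f x ≠ 0) :
    diff (n := n) f x (gradient (riemNorm h) f x) = riemNorm h x (gradient (riemNorm h) f x) ^ 2 := by
  rw [riemNorm, Real.sq_sqrt, inner_gradient_riemNorm h hx]
  by_cases h0 : gradient (riemNorm h) f x = 0
  · simp [h0]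
  · exact (h.pos x _ h0).le

end Gradient

end Randers

namespace Randers

/-! ### Derivatives of determinants and volumes of ellipsoids -/

section MatrixFacts

open Matrix

/-- Jacobi's formula: in the differentiated Leibniz expansion, the terms for column j form the
determinant with that column replaced by its derivative, which Cramer's rule expresses through the
adjugate. -/
theorem hasFDerivAt_det {ι E : Type*} [Fintype ι] [DecidableEq ι] [NormedAddCommGroup E]
    [NormedSpace ℝ E] {M : E → Matrix ι ι ℝ} {M' : ι → ι → E →L[ℝ] ℝ} {u : E}
    (hM : ∀ i j, HasFDerivAt (fun e => M e i j) (M' i j) u) :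
    HasFDerivAt (fun e => (M e).det) (∑ j, ∑ i, (M u).adjugate j i • M' i j) u := by
  have h1 : HasFDerivAt (fun e => ∑ σ : Equiv.Perm ι, (Equiv.Perm.sign σ : ℝ) * ∏ j, M e (σ j) j)
      (∑ σ : Equiv.Perm ι, (Equiv.Perm.sign σ : ℝ) •
        ∑ j, (∏ k ∈ Finset.univ.erase j, M u (σ k) k) • M' (σ j) j) u :=
    HasFDerivAt.fun_sum fun σ _ =>
      (HasFDerivAt.finsetProd fun j _ => hM (σ j) j).const_mul _
  simp only [Matrix.det_apply']
  refine h1.congr_fderiv ?_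
  ext v
  have h2 : ∀ j, ∑ i, (M u).adjugate j i * M' i j v =
      ∑ σ : Equiv.Perm ι, (Equiv.Perm.sign σ : ℝ) *
        ((∏ k ∈ Finset.univ.erase j, M u (σ k) k) * M' (σ j) j v) := by
    intro j
    have h3 := congrFun (Matrix.cramer_eq_adjugate_mulVec (M u) (fun i => M' i j v)) j
    rw [Matrix.cramer_apply, Matrix.det_apply'] at h3
    rw [show ∑ i, (M u).adjugate j i * M' i j v
      = ((M u).adjugate *ᵥ (fun i => M' i j v)) j from rfl, ← h3]
    refine Finset.sum_congr rfl fun σ _ => ?_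
    congr 1
    rw [← Finset.prod_erase_mul _ _ (Finset.mem_univ j)]
    congr 1
    · refine Finset.prod_congr rfl fun k hk => ?_
      rw [Matrix.updateCol_ne (Finset.ne_of_mem_erase hk)]
    · rw [Matrix.updateCol_self]
  simp only [_root_.sum_apply, _root_.smul_apply, smul_eq_mul, h2, Finset.mul_sum]
  rw [Finset.sum_comm]

theorem differentiableAt_det {ι E : Type*} [Fintype ι] [DecidableEq ι] [NormedAddCommGroup E]
    [NormedSpace ℝ E] {M : E → Matrix ι ι ℝ} {u : E}
    (hM : ∀ i j, DifferentiableAt ℝ (fun e => M e i j) u) :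
    DifferentiableAt ℝ (fun e => (M e).det) u :=
  (hasFDerivAt_det fun i j => (hM i j).hasFDerivAt).differentiableAt

theorem differentiableAt_inv_apply {ι E : Type*} [Fintype ι] [DecidableEq ι]
    [NormedAddCommGroup E] [NormedSpace ℝ E] {M : E → Matrix ι ι ℝ} {u : E}
    (hM : ∀ i j, DifferentiableAt ℝ (fun e => M e i j) u) (h0 : (M u).det ≠ 0) (i j : ι) :
    DifferentiableAt ℝ (fun e => (M e)⁻¹ i j) u := by
  simp only [Matrix.inv_def, Ring.inverse_eq_inv', Matrix.smul_apply, smul_eq_mul,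
    Matrix.adjugate_apply]
  refine ((differentiableAt_det hM).inv h0).mul (differentiableAt_det fun k l => ?_)
  simp only [Matrix.updateRow_apply]
  split_ifs
  · exact differentiableAt_const _
  · exact hM k l

/-- The ellipsoid is the preimage of the unit ball under the symmetric square root of G. -/
theorem volume_quadratic_lt_one {n : ℕ} {G : Matrix (Fin n) (Fin n) ℝ} (hG : G.PosDef) :
    MeasureTheory.volume.real {v : Model n | v.ofLp ⬝ᵥ (G *ᵥ v.ofLp) < 1} =
      MeasureTheory.volume.real (Metric.ball (0 : Model n) 1) / √G.det := by
  open scoped MatrixOrder in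
  obtain ⟨A, hA, hAs⟩ : ∃ A : Matrix (Fin n) (Fin n) ℝ, A * A = G ∧ A.IsHermitian :=
    ⟨CFC.sqrt G, CFC.sqrt_mul_sqrt_self G hG.posSemidef.nonneg,
      (CFC.sqrt_nonneg G).isSelfAdjoint⟩
  have hdet : G.det = A.det ^ 2 := by rw [← hA, Matrix.det_mul, sq]
  have hA0 : A.det ≠ 0 := by
    intro h0
    have := hG.det_pos
    rw [hdet, h0] at this
    simp at this
  have hset : {v : Model n | v.ofLp ⬝ᵥ (G *ᵥ v.ofLp) < 1} =
      (Matrix.toEuclideanLin A) ⁻¹' Metric.ball 0 1 := by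
    ext v
    have h1 : ‖Matrix.toEuclideanLin A v‖ ^ 2 = v.ofLp ⬝ᵥ (G *ᵥ v.ofLp) := by
      rw [EuclideanSpace.real_norm_sq_eq, ← hA, ← Matrix.mulVec_mulVec, Matrix.dotProduct_mulVec,
        ← Matrix.mulVec_transpose]
      have : Aᵀ = A := by simpa [Matrix.IsHermitian] using hAs
      rw [this]
      simp [dotProduct, sq]
    rw [Set.mem_ofPred_eq, Set.mem_preimage, mem_ball_zero_iff, ← h1]
    exact sq_lt_one_iff₀ (norm_nonneg _)
  have hd : LinearMap.det (Matrix.toEuclideanLin A) = A.det := by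
    rw [Matrix.toEuclideanLin, Matrix.toLpLin_eq_toLin, LinearMap.det_toLin]
  rw [hset, MeasureTheory.measureReal_def,
    MeasureTheory.Measure.addHaar_preimage_linearMap _ (by rw [hd]; exact hA0),
    ENNReal.toReal_mul, ENNReal.toReal_ofReal (abs_nonneg _), hd, hdet, Real.sqrt_sq_eq_abs,
    abs_inv, ← MeasureTheory.measureReal_def]
  rw [inv_mul_eq_div]

end MatrixFacts

/-! ### Chart components and the Busemann–Hausdorff volume -/

section Charts

open Matrix

variable {n : ℕ} {N : Type*} [TopologicalSpace N] [ChartedSpace (Model n) N]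
  [IsManifold (𝓡 n) ∞ N]

theorem mem_baseSet {c p : N} (hp : p ∈ (chartAt (Model n) c).source) :
    p ∈ (trivializationAt (Model n) (TangentSpace (𝓡 n)) c).baseSet := by
  rwa [TangentBundle.trivializationAt_baseSet]

theorem ofCoord_comps {c p : N} (hp : p ∈ (chartAt (Model n) c).source)
    (X : TangentSpace (𝓡 n) p) : ofCoord c p (comps c p X) = X :=
  (trivializationAt (Model n) (TangentSpace (𝓡 n)) c).symmL_continuousLinearMapAt
    (mem_baseSet hp) X

theorem comps_ofCoord {c p : N} (hp : p ∈ (chartAt (Model n) c).source) (v : Model n) :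
    comps c p (ofCoord c p v) = v :=
  (trivializationAt (Model n) (TangentSpace (𝓡 n)) c).continuousLinearMapAt_symmL
    (mem_baseSet hp) v

theorem comps_add (c p : N) (X Y : TangentSpace (𝓡 n) p) :
    comps c p (X + Y) = comps c p X + comps c p Y := map_add _ X Y

theorem comps_smul (c p : N) (r : ℝ) (X : TangentSpace (𝓡 n) p) :
    comps c p (r • X) = r • comps c p X := map_smul _ r X

theorem ofCoord_sub (c p : N) (v w : Model n) :
    (ofCoord c p (v - w) : TangentSpace (𝓡 n) p) = ofCoord c p v - ofCoord c p w := map_sub _ v w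

theorem ofCoord_eq_sum (c p : N) (v : Model n) :
    (ofCoord c p v : TangentSpace (𝓡 n) p) = ∑ i, v i • coordVec c p i := by
  have hv : v = ∑ i, v i • EuclideanSpace.single i (1 : ℝ) := by
    ext j
    simp [Pi.single_apply]
  conv_lhs => rw [hv]
  exact (map_sum _ _ _).trans (Finset.sum_congr rfl fun i _ => map_smul _ _ _)

theorem inner_ofCoord (h : RiemMetric n N) (c p : N) (v w : Model n) :
    h.inner p (ofCoord c p v) (ofCoord c p w) = v.ofLp ⬝ᵥ (metricCoeff h c p *ᵥ w.ofLp) := by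
  rw [ofCoord_eq_sum, ofCoord_eq_sum]
  simp only [map_sum, map_smul, _root_.sum_apply, _root_.smul_apply,
    smul_eq_mul, dotProduct, mulVec, metricCoeff, Finset.mul_sum]
  rw [Finset.sum_comm]
  refine Finset.sum_congr rfl fun i _ => Finset.sum_congr rfl fun j _ => ?_
  ring

theorem metricCoeff_posDef (h : RiemMetric n N) {c p : N}
    (hp : p ∈ (chartAt (Model n) c).source) : (metricCoeff h c p).PosDef := by
  refine Matrix.PosDef.of_dotProduct_mulVec_pos ?_ fun v hv => ?_
  · ext i j
    exact h.symm p _ _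
  · have := inner_ofCoord h c p (WithLp.toLp 2 v) (WithLp.toLp 2 v)
    simp only [star_trivial]
    rw [← this]
    refine h.pos p _ fun h0 => hv ?_
    have h1 := comps_ofCoord hp (WithLp.toLp 2 v)
    rw [h0] at h1
    have h2 : (0 : Model n) = WithLp.toLp 2 v := by
      rw [← h1]; exact (map_zero _).symm
    simpa using h2.symm

theorem riemVol_pos (h : RiemMetric n N) {c p : N}
    (hp : p ∈ (chartAt (Model n) c).source) : 0 < riemVol h c p :=
  Real.sqrt_pos.2 (metricCoeff_posDef h hp).det_pos

/-- The Busemann–Hausdorff volume form of a Randers metric is the Riemannian volume form of its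
navigation datum. -/
theorem volBH_randersMetric (h : RiemMetric n N) {W : (x : N) → TangentSpace (𝓡 n) x} {c p : N}
    (hW : h.inner p (W p) (W p) < 1) (hp : p ∈ (chartAt (Model n) c).source) :
    volBH (randersMetric h W) c p = riemVol h c p := by
  have hset : {v : Model n | randersMetric h W p (ofCoord c p v) < 1} =
      (fun v => v + -comps c p (W p)) ⁻¹'
        {v : Model n | v.ofLp ⬝ᵥ (metricCoeff h c p *ᵥ v.ofLp) < 1} := by
    ext v
    have h1 := navNorm_lt_one_iff (E := Model n) (B := h.inner p) (h.symm p) (h.pos p) hW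
      (ofCoord c p v)
    rw [Set.mem_preimage, Set.mem_ofPred_eq, Set.mem_ofPred_eq, ← inner_ofCoord, ← sub_eq_add_neg,
      ofCoord_sub, ofCoord_comps hp]
    exact h1
  have hball : MeasureTheory.volume.real (Metric.ball (0 : Model n) 1) ≠ 0 :=
    (ENNReal.toReal_pos (Metric.measure_ball_pos _ _ one_pos).ne'
      MeasureTheory.measure_ball_lt_top.ne).ne'
  rw [volBH, hset, MeasureTheory.measureReal_def _ (_ ⁻¹' _),
    MeasureTheory.measure_preimage_add_right, ← MeasureTheory.measureReal_def,
    volume_quadratic_lt_one (metricCoeff_posDef h hp), riemVol, div_div_cancel₀ hball]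

end Charts

end Randers

/-! ### Differential calculus in a chart -/

namespace Randers

open scoped Topology

variable {n : ℕ} {N : Type*} [TopologicalSpace N] [ChartedSpace (Model n) N]

/-- `q` is differentiable at the point `c`, when read in the chart at `c`. -/
def DiffInChartAt (n : ℕ) {N : Type*} [TopologicalSpace N] [ChartedSpace (Model n) N] (c : N)
    (q : N → ℝ) : Prop :=
  DifferentiableAt ℝ (fun u : Model n => q ((extChartAt (𝓡 n) c).symm u)) (extChartAt (𝓡 n) c c)

theorem tendsto_extChartAt_symm (c : N) :
    Filter.Tendsto (extChartAt (𝓡 n) c).symm (𝓝 (extChartAt (𝓡 n) c c)) (𝓝 c) := by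
  have := continuousAt_extChartAt_symm (I := 𝓡 n) c
  rwa [ContinuousAt, extChartAt_to_inv] at this

theorem partialAt_congr {c : N} {q q' : N → ℝ} (hq : q =ᶠ[𝓝 c] q') (i : Fin n) :
    partialAt c i q = partialAt c i q' := by
  have : (fun u : Model n => q ((extChartAt (𝓡 n) c).symm u)) =ᶠ[𝓝 (extChartAt (𝓡 n) c c)]
      fun u : Model n => q' ((extChartAt (𝓡 n) c).symm u) :=
    (tendsto_extChartAt_symm c).eventually hq
  rw [partialAt, this.fderiv_eq, partialAt]

theorem DiffInChartAt.congr {c : N} {q q' : N → ℝ} (h : DiffInChartAt n c q)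
    (hq : q' =ᶠ[𝓝 c] q) : DiffInChartAt n c q' :=
  DifferentiableAt.congr_of_eventuallyEq h ((tendsto_extChartAt_symm c).eventually hq)

theorem DiffInChartAt.mul {c : N} {q q' : N → ℝ} (h : DiffInChartAt n c q)
    (h' : DiffInChartAt n c q') : DiffInChartAt n c (fun p => q p * q' p) :=
  DifferentiableAt.fun_mul h h'

theorem partialAt_add {c : N} {q q' : N → ℝ} (h : DiffInChartAt n c q)
    (h' : DiffInChartAt n c q') (i : Fin n) :
    partialAt c i (fun p => q p + q' p) = partialAt c i q + partialAt c i q' := by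
  simp only [partialAt]
  rw [fderiv_fun_add h h', add_apply]

theorem partialAt_mul {c : N} {q q' : N → ℝ} (h : DiffInChartAt n c q)
    (h' : DiffInChartAt n c q') (i : Fin n) :
    partialAt c i (fun p => q p * q' p) = q c * partialAt c i q' + partialAt c i q * q' c := by
  simp only [partialAt]
  rw [fderiv_fun_mul h h', add_apply, smul_apply, smul_apply, extChartAt_to_inv, smul_eq_mul,
    smul_eq_mul, mul_comm (q' c)]

theorem DiffInChartAt.comp {c : N} {q : N → ℝ} {g : ℝ → ℝ} (h : DiffInChartAt n c q)
    (hg : DifferentiableAt ℝ g (q c)) : DiffInChartAt n c (fun p => g (q p)) := by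
  refine DifferentiableAt.fun_comp' (g := g) _ ?_ h
  rwa [extChartAt_to_inv]

theorem partialAt_comp {c : N} {q : N → ℝ} {g : ℝ → ℝ} (h : DiffInChartAt n c q)
    (hg : DifferentiableAt ℝ g (q c)) (i : Fin n) :
    partialAt c i (fun p => g (q p)) = deriv g (q c) * partialAt c i q := by
  have hg' : HasDerivAt g (deriv g (q c)) (q ((extChartAt (𝓡 n) c).symm (extChartAt (𝓡 n) c c))) := by
    rw [extChartAt_to_inv]; exact hg.hasDerivAt
  have h' : DifferentiableAt ℝ (fun u : Model n => q ((extChartAt (𝓡 n) c).symm u))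
      (extChartAt (𝓡 n) c c) := h
  have := hg'.comp_hasFDerivAt (extChartAt (𝓡 n) c c) h'.hasFDerivAt
  simp only [partialAt]
  rw [show (fun u : Model n => g (q ((extChartAt (𝓡 n) c).symm u))) =
    g ∘ (fun u : Model n => q ((extChartAt (𝓡 n) c).symm u)) from rfl, this.fderiv, smul_apply,
    smul_eq_mul]

theorem contDiffAt_extChartAt {m : WithTop ℕ∞} {c : N} {q : N → ℝ}
    (hq : ContMDiffAt (𝓡 n) 𝓘(ℝ, ℝ) m q c) :
    ContDiffAt ℝ m (fun u : Model n => q ((extChartAt (𝓡 n) c).symm u))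
      (extChartAt (𝓡 n) c c) := by
  have := (contMDiffAt_iff.1 hq).2
  rw [ModelWithCorners.range_eq_univ, contDiffWithinAt_univ] at this
  exact this

theorem DiffInChartAt.of_contMDiffAt {m : WithTop ℕ∞} {c : N} {q : N → ℝ} (hm : m ≠ 0)
    (hq : ContMDiffAt (𝓡 n) 𝓘(ℝ, ℝ) m q c) : DiffInChartAt n c q :=
  (contDiffAt_extChartAt hq).differentiableAt hm

theorem mem_chart_source_eventually (c : N) :
    ∀ᶠ p in 𝓝 c, p ∈ (chartAt (Model n) c).source :=
  (chartAt (Model n) c).open_source.mem_nhds (mem_chart_source _ c)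

variable [IsManifold (𝓡 n) ∞ N]

/-- Stated at every p of the chart domain, not only its centre, because the components of df are
themselves differentiated later. -/
theorem fderiv_extChartAt_symm {c p : N} (hp : p ∈ (chartAt (Model n) c).source) {q : N → ℝ}
    (hq : MDifferentiableAt (𝓡 n) 𝓘(ℝ, ℝ) q p) (v : Model n) :
    fderiv ℝ (fun u : Model n => q ((extChartAt (𝓡 n) c).symm u)) (extChartAt (𝓡 n) c p) v =
      diff q p (ofCoord c p v) := by
  have hp' : p ∈ (extChartAt (𝓡 n) c).source := by rwa [extChartAt_source]
  have h1 := mdifferentiableWithinAt_extChartAt_symm (I := 𝓡 n)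
    ((extChartAt (𝓡 n) c).map_source hp')
  have h3 : ofCoord c p v = mfderivWithin 𝓘(ℝ, Model n) (𝓡 n) (extChartAt (𝓡 n) c).symm
      (Set.range (𝓡 n)) (extChartAt (𝓡 n) c p) v := by
    rw [ofCoord, TangentBundle.symmL_trivializationAt hp]
    rfl
  rw [ModelWithCorners.range_eq_univ, mdifferentiableWithinAt_univ] at h1
  rw [ModelWithCorners.range_eq_univ, mfderivWithin_univ] at h3
  have hinv := (extChartAt (𝓡 n) c).left_inv hp'
  have h2 : MDifferentiableAt (𝓡 n) 𝓘(ℝ, ℝ) q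
      ((extChartAt (𝓡 n) c).symm (extChartAt (𝓡 n) c p)) := by rwa [hinv]
  have h4 := mfderiv_comp _ h2 h1
  rw [mfderiv_eq_fderiv] at h4
  -- The chain rule yields the differential at the image of p under the chart and back, which is p
  -- only propositionally; both differentials are compared as maps on `Model n`.
  have h5 : ∀ p' : N, p' = p → ∀ w : Model n,
      (mfderiv (𝓡 n) 𝓘(ℝ, ℝ) q p' : Model n →L[ℝ] ℝ) w =
        (mfderiv (𝓡 n) 𝓘(ℝ, ℝ) q p : Model n →L[ℝ] ℝ) w := by
    rintro _ rfl w
    rfl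
  rw [h3]
  exact (congrArg (fun L : Model n →L[ℝ] ℝ => L v) h4).trans (h5 _ hinv _)

theorem sum_comps_mul_partialAt {c : N} {q : N → ℝ}
    (hq : MDifferentiableAt (𝓡 n) 𝓘(ℝ, ℝ) q c) (X : TangentSpace (𝓡 n) c) :
    ∑ i, comps c c X i * partialAt c i q = diff q c X := by
  have hc := mem_chart_source (Model n) c
  conv_rhs => rw [← ofCoord_comps hc X, ofCoord_eq_sum, map_sum]
  refine Finset.sum_congr rfl fun i _ => ?_
  rw [map_smul, smul_eq_mul, partialAt, fderiv_extChartAt_symm hc hq]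
  rfl

theorem contMDiffAt_coordVec (c : N) (i : Fin n) :
    ContMDiffAt (𝓡 n) (𝓡 n).tangent ∞
      (fun p : N => (⟨p, coordVec c p i⟩ : TangentBundle (𝓡 n) N)) c := by
  refine (Bundle.contMDiffAt_section c).2 ?_
  refine (contMDiffAt_const (c := EuclideanSpace.single i (1 : ℝ))).congr_of_eventuallyEq ?_
  filter_upwards [mem_chart_source_eventually (n := n) c] with p hp
  rw [← Bundle.Trivialization.continuousLinearMapAt_apply_of_mem ℝ _ (mem_baseSet (n := n) hp)]
  exact comps_ofCoord hp _

theorem contMDiffAt_comps {X : (x : N) → TangentSpace (𝓡 n) x} {c : N}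
    (hX : ContMDiffAt (𝓡 n) (𝓡 n).tangent ∞
      (fun x : N => (⟨x, X x⟩ : TangentBundle (𝓡 n) N)) c) (i : Fin n) :
    ContMDiffAt (𝓡 n) 𝓘(ℝ, ℝ) ∞ (fun p => comps c p (X p) i) c := by
  have h1 := (Bundle.contMDiffAt_section c).1 hX
  have h2 : ContMDiffAt (𝓡 n) 𝓘(ℝ, Model n) ∞ (fun p => comps c p (X p)) c := by
    refine h1.congr_of_eventuallyEq ?_
    filter_upwards [mem_chart_source_eventually (n := n) c] with p hp
    rw [← Bundle.Trivialization.continuousLinearMapAt_apply_of_mem ℝ _ (mem_baseSet (n := n) hp)]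
    rfl
  exact (EuclideanSpace.proj (𝕜 := ℝ) i).contMDiff.contMDiffAt.comp c h2

theorem contMDiffAt_metricCoeff (h : RiemMetric n N) (c : N) (i j : Fin n) :
    ContMDiffAt (𝓡 n) 𝓘(ℝ, ℝ) ∞ (fun p => metricCoeff h c p i j) c := by
  have h1 := ContMDiffAt.clm_bundle_apply₂ (b := fun p : N => p) (F₃ := ℝ)
    (E₃ := Bundle.Trivial N ℝ) h.contMDiff.contMDiffAt (contMDiffAt_coordVec c i)
    (contMDiffAt_coordVec c j)
  exact (Bundle.contMDiffAt_section c).1 h1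

end Randers

namespace Randers

open scoped Topology Matrix

variable {n : ℕ} {N : Type*} [TopologicalSpace N] [ChartedSpace (Model n) N]

/-! ### Openness of the regular set and of its values -/

section Regular

variable [IsManifold (𝓡 n) ∞ N]

theorem diff_eq_zero_iff {c p : N} (hp : p ∈ (chartAt (Model n) c).source) {q : N → ℝ}
    (hq : MDifferentiableAt (𝓡 n) 𝓘(ℝ, ℝ) q p) :
    diff (n := n) q p = 0 ↔
      fderiv ℝ (fun u : Model n => q ((extChartAt (𝓡 n) c).symm u)) (extChartAt (𝓡 n) c p) = 0 := by
  constructor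
  · intro h
    ext v
    rw [fderiv_extChartAt_symm hp hq, h]
    rfl
  · intro h
    ext X
    rw [← ofCoord_comps hp X, ← fderiv_extChartAt_symm hp hq, h]
    rfl

theorem isOpen_regularSet {f : N → ℝ} (hf : ContMDiff (𝓡 n) 𝓘(ℝ, ℝ) 1 f) :
    IsOpen (regularSet n f) := by
  rw [isOpen_iff_mem_nhds]
  intro c hc
  have hmd : ∀ p, MDifferentiableAt (𝓡 n) 𝓘(ℝ, ℝ) f p := fun p =>
    (hf p).mdifferentiableAt one_ne_zero
  have h0 : fderiv ℝ (fun u : Model n => f ((extChartAt (𝓡 n) c).symm u))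
      (extChartAt (𝓡 n) c c) ≠ 0 := fun h0 =>
    hc ((diff_eq_zero_iff (mem_chart_source _ c) (hmd c)).2 h0)
  have h1 : ContinuousAt (fderiv ℝ (fun u : Model n => f ((extChartAt (𝓡 n) c).symm u)))
      (extChartAt (𝓡 n) c c) :=
    ((contDiffAt_extChartAt (hf c)).fderiv_right (m := 0) (by norm_num)).continuousAt
  have h2 := (continuousAt_extChartAt (I := 𝓡 n) c).eventually (h1.eventually_ne h0)
  filter_upwards [h2, mem_chart_source_eventually (n := n) c] with p hp hp'
  exact fun h => hp ((diff_eq_zero_iff hp' (hmd p)).1 h)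

/-- A real function with nonzero differential is locally open. Openness of J is what makes `deriv φ`
meaningful and continuous when φ is only smooth on J. -/
theorem isOpen_regularValues {f : N → ℝ} (hf : ContMDiff (𝓡 n) 𝓘(ℝ, ℝ) 1 f) :
    IsOpen (regularValues n f) := by
  rw [isOpen_iff_mem_nhds]
  rintro _ ⟨c, hc, rfl⟩
  have h0 : fderiv ℝ (fun u : Model n => f ((extChartAt (𝓡 n) c).symm u))
      (extChartAt (𝓡 n) c c) ≠ 0 := fun h0 =>
    hc ((diff_eq_zero_iff (mem_chart_source _ c) ((hf c).mdifferentiableAt one_ne_zero)).2 h0)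
  have h1 := (contDiffAt_extChartAt (hf c)).hasStrictFDerivAt one_ne_zero
  have h2 := h1.map_nhds_eq_of_surj (LinearMap.range_eq_top.2
    (LinearMap.surjective fun h => h0 (ContinuousLinearMap.ext fun v => LinearMap.congr_fun h v)))
  rw [extChartAt_to_inv] at h2
  rw [← h2, Filter.mem_map]
  filter_upwards [(tendsto_extChartAt_symm c).eventually
    ((isOpen_regularSet hf).mem_nhds hc)] with u hu
  exact ⟨_, hu, rfl⟩

end Regular

/-! ### Divergence with respect to the Riemannian volume -/

section MetricCalculus

variable [IsManifold (𝓡 n) ∞ N]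

/-- In coordinates the gradient is G⁻¹ applied to the components of df, and both factors are
differentiable. -/
theorem diffInChartAt_comps_gradient (h : RiemMetric n N) {f : N → ℝ} {c : N}
    (hf : ContMDiffAt (𝓡 n) 𝓘(ℝ, ℝ) ∞ f c)
    (hreg : ∀ᶠ p in 𝓝 c, diff (n := n) f p ≠ 0) (i : Fin n) :
    DiffInChartAt n c (fun p => comps c p (gradient (riemNorm h) f p) i) := by
  set fc : Model n → ℝ := fun u => f ((extChartAt (𝓡 n) c).symm u) with hfc
  have hG : ∀ j k, DiffInChartAt n c (fun p => metricCoeff h c p j k) := fun j k =>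
    .of_contMDiffAt (by simp) (contMDiffAt_metricCoeff h c j k)
  have hξ : ∀ j : Fin n, DiffInChartAt n c (fun p => diff f p (coordVec c p j)) := by
    intro j
    have h1 : DifferentiableAt ℝ (fun u => fderiv ℝ fc u (EuclideanSpace.single j 1))
        (extChartAt (𝓡 n) c c) :=
      (((contDiffAt_extChartAt hf).fderiv_right (m := 1) (by norm_cast)).differentiableAt
        one_ne_zero).clm_apply (differentiableAt_const _)
    refine h1.congr_of_eventuallyEq ?_
    -- `mfderiv` is zero by default where f is not differentiable, so a nonzero value forces
    -- differentiability.
    have h2 : ∀ᶠ p in 𝓝 c, MDifferentiableAt (𝓡 n) 𝓘(ℝ, ℝ) f p := by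
      filter_upwards [hreg] with p hp
      by_contra hnd
      exact hp (mfderiv_zero_of_not_mdifferentiableAt hnd)
    filter_upwards [(tendsto_extChartAt_symm c).eventually h2,
      (tendsto_extChartAt_symm c).eventually (mem_chart_source_eventually (n := n) c),
      extChartAt_target_mem_nhds (I := 𝓡 n) c] with u hu hu' hut
    have := fderiv_extChartAt_symm hu' hu (EuclideanSpace.single j 1)
    rw [(extChartAt (𝓡 n) c).right_inv hut] at this
    exact this.symm
  have hc := mem_chart_source (Model n) c
  have h1 : DiffInChartAt n c
      (fun p => ∑ j, (metricCoeff h c p)⁻¹ i j * diff f p (coordVec c p j)) := by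
    refine DifferentiableAt.fun_sum fun j _ => DifferentiableAt.fun_mul ?_ (hξ j)
    refine differentiableAt_inv_apply (M := fun u : Model n =>
      metricCoeff h c ((extChartAt (𝓡 n) c).symm u)) hG ?_ i j
    rw [extChartAt_to_inv]
    exact (metricCoeff_posDef h hc).det_pos.ne'
  refine h1.congr ?_
  filter_upwards [hreg, mem_chart_source_eventually (n := n) c] with p hp hp'
  have h2 : metricCoeff h c p *ᵥ (comps c p (gradient (riemNorm h) f p)).ofLp =
      fun j => diff f p (coordVec c p j) := by
    ext j
    have h3 := inner_ofCoord h c p (EuclideanSpace.single j 1)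
      (comps c p (gradient (riemNorm h) f p))
    rw [ofCoord_comps hp', h.symm, inner_gradient_riemNorm h hp] at h3
    rw [coordVec, h3]
    simp
  have hdet : IsUnit (metricCoeff h c p).det := (metricCoeff_posDef h hp').det_pos.ne'.isUnit
  change _ = ((metricCoeff h c p)⁻¹ *ᵥ fun j => diff f p (coordVec c p j)) i
  rw [← h2, Matrix.mulVec_mulVec, Matrix.nonsing_inv_mul _ hdet, Matrix.one_mulVec]

/-- Jacobi's formula for the Riemannian volume form. -/
theorem diffInChartAt_riemVol (h : RiemMetric n N) (c : N) :
    DiffInChartAt n c (fun p => riemVol h c p) ∧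
    ∀ i : Fin n, partialAt c i (fun p => riemVol h c p) = riemVol h c c * (2⁻¹ *
      ∑ k, ∑ j, (metricCoeff h c c)⁻¹ k j * partialAt c i (fun p => metricCoeff h c p j k)) := by
  have hG : ∀ j k, DiffInChartAt n c (fun p => metricCoeff h c p j k) := fun j k =>
    .of_contMDiffAt (by simp) (contMDiffAt_metricCoeff h c j k)
  have hpos := (metricCoeff_posDef h (mem_chart_source (Model n) c)).det_pos
  have h1 := hasFDerivAt_det (M := fun u : Model n =>
    metricCoeff h c ((extChartAt (𝓡 n) c).symm u)) fun j k =>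
      DifferentiableAt.hasFDerivAt (hG j k)
  have h2 := h1.sqrt (by rw [extChartAt_to_inv]; exact hpos.ne')
  refine ⟨h2.differentiableAt, fun i => ?_⟩
  have h3 : partialAt c i (fun p => riemVol h c p) = _ :=
    congrArg (fun L : Model n →L[ℝ] ℝ => L (EuclideanSpace.single i 1)) h2.fderiv
  rw [h3]
  simp only [extChartAt_to_inv, smul_apply, _root_.sum_apply, smul_eq_mul, Matrix.inv_def,
    Matrix.smul_apply, Ring.inverse_eq_inv', riemVol]
  have hs := Real.sq_sqrt hpos.le
  have hs0 := (Real.sqrt_pos.2 hpos).ne'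
  simp only [mul_assoc, ← Finset.mul_sum]
  conv_rhs => rw [show (metricCoeff h c c).det⁻¹ = (√(metricCoeff h c c).det)⁻¹ ^ 2 by
    rw [inv_pow, hs]]
  field_simp
  rfl

theorem divergence_congr {σ σ' : N → N → ℝ} {X Y : (x : N) → TangentSpace (𝓡 n) x} {x : N}
    (hσ : ∀ᶠ p in 𝓝 x, σ x p = σ' x p) (hX : ∀ᶠ p in 𝓝 x, X p = Y p) :
    divergence σ X x = divergence σ' Y x := by
  rw [divergence, divergence, hσ.self_of_nhds]
  congr 1
  refine Finset.sum_congr rfl fun i _ => partialAt_congr ?_ i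
  filter_upwards [hσ, hX] with p hp hp'
  rw [hp, hp']

theorem divergence_add {σ : N → N → ℝ} {X Y : (x : N) → TangentSpace (𝓡 n) x} {x : N}
    (hσ : DiffInChartAt n x (σ x)) (hX : ∀ i, DiffInChartAt n x (fun p => comps x p (X p) i))
    (hY : ∀ i, DiffInChartAt n x (fun p => comps x p (Y p) i)) :
    divergence σ (fun p => X p + Y p) x = divergence σ X x + divergence σ Y x := by
  rw [divergence, divergence, divergence, ← mul_add, ← Finset.sum_add_distrib]
  congr 1
  refine Finset.sum_congr rfl fun i _ => ?_
  rw [← partialAt_add (hσ.mul (hX i)) (hσ.mul (hY i))]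
  congr 1
  funext p
  rw [comps_add, PiLp.add_apply, mul_add]

theorem diffInChartAt_comps_smul {X : (x : N) → TangentSpace (𝓡 n) x} {x : N} {g : N → ℝ}
    (hX : ∀ i, DiffInChartAt n x (fun p => comps x p (X p) i)) (hg : DiffInChartAt n x g)
    (i : Fin n) : DiffInChartAt n x (fun p => comps x p (g p • X p) i) := by
  refine (hg.mul (hX i)).congr (Filter.Eventually.of_forall fun p => ?_)
  simp only [comps_smul, PiLp.smul_apply, smul_eq_mul]

theorem divergence_smul {σ : N → N → ℝ} {X : (x : N) → TangentSpace (𝓡 n) x} {x : N} {g : N → ℝ}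
    (hσ : DiffInChartAt n x (σ x)) (h0 : σ x x ≠ 0)
    (hX : ∀ i, DiffInChartAt n x (fun p => comps x p (X p) i)) (hg : DiffInChartAt n x g) :
    divergence σ (fun p => g p • X p) x =
      g x * divergence σ X x + ∑ i, comps x x (X x) i * partialAt x i g := by
  have h1 : ∀ i, partialAt x i (fun p => σ x p * comps x p (g p • X p) i) =
      g x * partialAt x i (fun p => σ x p * comps x p (X p) i) +
        σ x x * (comps x x (X x) i * partialAt x i g) := by
    intro i
    have h2 := partialAt_mul hg (hσ.mul (hX i)) i
    rw [show (fun p => σ x p * comps x p (g p • X p) i) =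
      fun p => g p * (σ x p * comps x p (X p) i) by
        funext p; rw [comps_smul, PiLp.smul_apply, smul_eq_mul]; ring, h2]
    ring
  simp only [divergence, h1, Finset.sum_add_distrib, ← Finset.mul_sum]
  field_simp

/-- The divergence of a homothetic vector field. -/
theorem divergence_homothetic (h : RiemMetric n N) {W : (x : N) → TangentSpace (𝓡 n) x} {k₀ : ℝ}
    (hW : ∀ x i, DiffInChartAt n x (fun p => comps x p (W p) i))
    (hhom : IsHomothetic h W k₀) (x : N) :
    divergence (riemVol h) W x = -2 * n * k₀ := by
  obtain ⟨hσ, hdσ⟩ := diffInChartAt_riemVol h x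
  have h0 := riemVol_pos h (mem_chart_source (Model n) x)
  set G := metricCoeff h x x with hGdef
  set w : Fin n → ℝ := fun i => comps x x (W x) i with hw
  set dW : Fin n → Fin n → ℝ := fun i k => partialAt x i (fun p => comps x p (W p) k) with hdW
  set dG : Fin n → Fin n → Fin n → ℝ :=
    fun i j k => partialAt x i (fun p => metricCoeff h x p j k) with hdG
  have hdet : IsUnit G.det :=
    (metricCoeff_posDef h (mem_chart_source (Model n) x)).det_pos.ne'.isUnit
  have hmul : ∀ i j, ∑ k, G i k * G⁻¹ k j = if i = j then 1 else 0 := fun i j => by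
    rw [← Matrix.mul_apply, Matrix.mul_nonsing_inv _ hdet, Matrix.one_apply]
  have hmul' : ∀ i j, ∑ k, G⁻¹ i k * G k j = if i = j then 1 else 0 := fun i j => by
    rw [← Matrix.mul_apply, Matrix.nonsing_inv_mul _ hdet, Matrix.one_apply]
  -- Jacobi's formula gives div W = ∂ᵢWⁱ + ½ Gᵏʲ W(Gⱼₖ).
  have h1 : divergence (riemVol h) W x =
      ∑ i, dW i i + 2⁻¹ * ∑ k, ∑ j, G⁻¹ k j * ∑ i, w i * dG i j k := by
    have h2 : ∀ i, partialAt x i (fun p => riemVol h x p * comps x p (W p) i) =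
        riemVol h x x * (dW i i + 2⁻¹ * ∑ k, ∑ j, G⁻¹ k j * (w i * dG i j k)) := by
      intro i
      rw [partialAt_mul hσ (hW x i), hdσ]
      have : ∑ k, ∑ j, G⁻¹ k j * (w i * dG i j k) = (∑ k, ∑ j, G⁻¹ k j * dG i j k) * w i := by
        simp only [Finset.sum_mul]
        exact Finset.sum_congr rfl fun _ _ => Finset.sum_congr rfl fun _ _ => by ring
      rw [this]
      ring
    rw [divergence, Finset.sum_congr rfl fun i _ => h2 i, ← Finset.mul_sum, ← mul_assoc,
      inv_mul_cancel₀ h0.ne', one_mul, Finset.sum_add_distrib, ← Finset.mul_sum]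
    congr 2
    rw [Finset.sum_comm]
    refine Finset.sum_congr rfl fun k _ => ?_
    rw [Finset.sum_comm]
    exact Finset.sum_congr rfl fun j _ => (Finset.mul_sum _ _ _).symm
  -- The homothety equation solved for W(Gⱼₖ). Traced with G⁻¹, each of the two derivative terms
  -- contributes ∂ᵢWⁱ; with the factor ½ they cancel the first term of `h1` and leave -2nk₀.
  have h2 : ∀ j k, ∑ i, w i * dG i j k =
      -4 * k₀ * G j k - ∑ i, G i k * dW j i - ∑ i, G j i * dW k i := by
    intro j k
    have := hhom x j k
    rw [lieDerivMetric, Finset.sum_add_distrib, Finset.sum_add_distrib] at this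
    linarith
  have h3 : ∑ k, ∑ j, G⁻¹ k j * (-4 * k₀ * G j k) = -4 * k₀ * n := by
    have : ∀ k, ∑ j, G⁻¹ k j * (-4 * k₀ * G j k) = -4 * k₀ := fun k => by
      rw [Finset.sum_congr rfl fun j _ => (show G⁻¹ k j * (-4 * k₀ * G j k) =
        -4 * k₀ * (G⁻¹ k j * G j k) by ring), ← Finset.mul_sum, hmul']
      simp
    simp only [this, Finset.sum_const, Finset.card_univ, Fintype.card_fin, nsmul_eq_mul]
    ring
  have h4 : ∑ k, ∑ j, G⁻¹ k j * ∑ i, G i k * dW j i = ∑ i, dW i i := by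
    rw [Finset.sum_comm]
    refine Finset.sum_congr rfl fun j _ => ?_
    simp only [Finset.mul_sum]
    rw [Finset.sum_comm]
    have : ∀ i, ∑ k, G⁻¹ k j * (G i k * dW j i) = (if i = j then 1 else 0) * dW j i := fun i => by
      rw [← hmul, Finset.sum_mul]
      exact Finset.sum_congr rfl fun k _ => by ring
    simp [this]
  have h5 : ∑ k, ∑ j, G⁻¹ k j * ∑ i, G j i * dW k i = ∑ i, dW i i := by
    refine Finset.sum_congr rfl fun k _ => ?_
    simp only [Finset.mul_sum]
    rw [Finset.sum_comm]
    have : ∀ i, ∑ j, G⁻¹ k j * (G j i * dW k i) = (if k = i then 1 else 0) * dW k i := fun i => by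
      rw [← hmul', Finset.sum_mul]
      exact Finset.sum_congr rfl fun k _ => by ring
    simp [this]
  rw [h1]
  simp only [h2, mul_sub, Finset.sum_sub_distrib, h3, h4, h5]
  ring

end MetricCalculus

/-! ### The Laplacian of a Randers metric -/

section Laplacian

variable [IsManifold (𝓡 n) ∞ N]

/-- The Laplacian of a Randers metric, for a function with `‖∇f‖ = a(f)` and `df(W) = φ(f)`. -/
theorem laplacian_randersMetric (h : RiemMetric n N) {W : (x : N) → TangentSpace (𝓡 n) x}
    (hW : ContMDiff (𝓡 n) (𝓡 n).tangent ∞ (fun x : N => (⟨x, W x⟩ : TangentBundle (𝓡 n) N)))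
    (hW1 : ∀ x : N, h.inner x (W x) (W x) < 1) {k₀ : ℝ} (hhom : IsHomothetic h W k₀)
    {f : N → ℝ} {a φ : ℝ → ℝ} {x : N} (hf : ContMDiffAt (𝓡 n) 𝓘(ℝ, ℝ) ∞ f x)
    (hreg : ∀ᶠ p in 𝓝 x, diff (n := n) f p ≠ 0)
    (ha : ∀ᶠ p in 𝓝 x, riemNorm h p (gradient (riemNorm h) f p) = a (f p))
    (hφ : ∀ᶠ p in 𝓝 x, diff f p (W p) = φ (f p))
    (hda : DifferentiableAt ℝ a (f x)) (hdφ : DifferentiableAt ℝ φ (f x)) :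
    laplacian (randersMetric h W) (volBH (randersMetric h W)) f x =
      (a (f x) + φ (f x)) * (laplacian (riemNorm h) (riemVol h) f x / a (f x) - 2 * n * k₀
        + deriv φ (f x)) := by
  have hWd : ∀ x i, DiffInChartAt n x (fun p => comps x p (W p) i) := fun x i =>
    .of_contMDiffAt (by simp) (contMDiffAt_comps (hW x) i)
  have hXd := diffInChartAt_comps_gradient h hf hreg
  obtain ⟨hσ, -⟩ := diffInChartAt_riemVol h x
  have hσ0 := (riemVol_pos h (mem_chart_source (Model n) x)).ne'
  have hfd : DiffInChartAt n x f := .of_contMDiffAt (by simp) hf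
  have hfm : MDifferentiableAt (𝓡 n) 𝓘(ℝ, ℝ) f x := hf.mdifferentiableAt (by simp)
  have ha0 : 0 < a (f x) := by
    rw [← ha.self_of_nhds]
    exact riemNorm_gradient_pos h hreg.self_of_nhds
  -- The Finsler gradient is g₁(f) ∇ʰf + g₂(f) W near x.
  set g₁ : ℝ → ℝ := fun t => (a t + φ t) * (a t)⁻¹ with hg₁
  set g₂ : ℝ → ℝ := fun t => a t + φ t with hg₂
  have hd₂ : HasDerivAt g₂ (deriv a (f x) + deriv φ (f x)) (f x) :=
    hda.hasDerivAt.add hdφ.hasDerivAt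
  have hd₁ := hd₂.mul (hda.hasDerivAt.inv ha0.ne')
  change HasDerivAt g₁ _ _ at hd₁
  have hsum : ∀ (X : TangentSpace (𝓡 n) x) {g : ℝ → ℝ}, DifferentiableAt ℝ g (f x) →
      ∑ i, comps x x X i * partialAt x i (fun p => g (f p)) = deriv g (f x) * diff f x X := by
    intro X g hg
    rw [← sum_comps_mul_partialAt hfm, Finset.mul_sum]
    refine Finset.sum_congr rfl fun i _ => ?_
    rw [partialAt_comp hfd hg]
    ring
  have h1 : laplacian (randersMetric h W) (volBH (randersMetric h W)) f x =
      divergence (riemVol h)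
        (fun p => g₁ (f p) • gradient (riemNorm h) f p + g₂ (f p) • W p) x := by
    refine divergence_congr ?_ ?_
    · filter_upwards [mem_chart_source_eventually (n := n) x] with p hp
      exact volBH_randersMetric h (hW1 p) hp
    · filter_upwards [hreg, ha, hφ] with p hp hap hφp
      rw [gradient_randersMetric_eq h (hW1 p) hp, hap, hφp, smul_add, smul_smul]
  have hc₁ := hfd.comp hd₁.differentiableAt
  have hc₂ := hfd.comp hd₂.differentiableAt
  rw [h1, divergence_add hσ (diffInChartAt_comps_smul hXd hc₁)
    (diffInChartAt_comps_smul (hWd x) hc₂), divergence_smul hσ hσ0 hXd hc₁,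
    divergence_smul hσ hσ0 (hWd x) hc₂, hsum _ hd₁.differentiableAt, hsum _ hd₂.differentiableAt,
    divergence_homothetic h hWd hhom, hd₁.deriv, hd₂.deriv,
    diff_gradient_riemNorm h hreg.self_of_nhds, ha.self_of_nhds, hφ.self_of_nhds,
    show divergence (riemVol h) (gradient (riemNorm h) f) x
      = laplacian (riemNorm h) (riemVol h) f x from rfl]
  -- The Leibniz terms are g₁' a² + g₂' φ; the derivative of a cancels between them, leaving (a + φ)
  -- φ'.
  simp only [hg₁, hg₂]
  have := ha0.ne'
  simp only [Pi.inv_apply]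
  field_simp
  ring

end Laplacian

end Randers

/-! ### The isoparametric condition -/

namespace Randers

open scoped Topology

/-- Every t in J is f(x) for a regular x, so the pointwise formulas determine a' and b' on J;
outside J they are unconstrained. Continuity of b' uses a ≠ 0 on J and continuity of `deriv φ` on
the open set J. -/
theorem isIsoparametricWith_randersMetric {n : ℕ} {N : Type*} [TopologicalSpace N]
    [ChartedSpace (Model n) N] [IsManifold (𝓡 n) ∞ N] (h : RiemMetric n N)
    {W : (x : N) → TangentSpace (𝓡 n) x}
    (hW : ContMDiff (𝓡 n) (𝓡 n).tangent ∞ (fun x : N => (⟨x, W x⟩ : TangentBundle (𝓡 n) N)))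
    (hW1 : ∀ x : N, h.inner x (W x) (W x) < 1) {k₀ : ℝ} (hhom : IsHomothetic h W k₀)
    {f : N → ℝ} {a b φ : ℝ → ℝ}
    (hf : IsIsoparametricWith (riemNorm h) (riemVol h) f a b)
    (hφ : ContDiffOn ℝ ∞ φ (regularValues n f))
    (hWf : ∀ x ∈ regularSet n f, diff f x (W x) = φ (f x)) (a' b' : ℝ → ℝ) :
    IsIsoparametricWith (randersMetric h W) (volBH (randersMetric h W)) f a' b' ↔
      ∀ t ∈ regularValues n f, a' t = a t + φ t ∧
        b' t = (a t + φ t) * (b t / a t - 2 * n * k₀ + deriv φ t) := by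
  have hN := isOpen_regularSet hf.contMDiff
  have hJ := isOpen_regularValues hf.contMDiff
  have hnorm : ∀ x ∈ regularSet n f, randersMetric h W x (gradient (randersMetric h W) f x) =
      a (f x) + φ (f x) := fun x hx => by
    rw [randersMetric_gradient_eq h (hW1 x) hx, hf.norm_gradient x hx, hWf x hx]
  have hlap : ∀ x ∈ regularSet n f,
      laplacian (randersMetric h W) (volBH (randersMetric h W)) f x =
        (a (f x) + φ (f x)) * (b (f x) / a (f x) - 2 * n * k₀ + deriv φ (f x)) := fun x hx => by
    have hx' := hN.mem_nhds hx
    have hfx := hJ.mem_nhds (Set.mem_image_of_mem f hx)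
    rw [laplacian_randersMetric (a := a) (φ := φ) h hW hW1 hhom
      ((hf.smoothOn x hx).contMDiffAt hx') hx' (Filter.eventually_of_mem hx' hf.norm_gradient)
      (Filter.eventually_of_mem hx' hWf)
      ((hf.smooth_a.contDiffAt hfx).differentiableAt (by simp))
      ((hφ.contDiffAt hfx).differentiableAt (by simp)), hf.laplacian_eq x hx]
  constructor
  · rintro h' _ ⟨x, hx, rfl⟩
    exact ⟨by rw [← h'.norm_gradient x hx, hnorm x hx],
      by rw [← h'.laplacian_eq x hx, hlap x hx]⟩
  · intro h'
    have ha0 : ∀ t ∈ regularValues n f, a t ≠ 0 := by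
      rintro _ ⟨x, hx, rfl⟩
      rw [← hf.norm_gradient x hx]
      exact (riemNorm_gradient_pos h hx).ne'
    have hac := hf.smooth_a.continuousOn
    have hφc := hφ.continuousOn
    have hφ' := hφ.continuousOn_deriv_of_isOpen hJ (by simp)
    refine ⟨hf.nonconstant, hf.contMDiff, hf.smoothOn,
      (hf.smooth_a.add hφ).congr fun t ht => (h' t ht).1,
      ContinuousOn.congr ?_ fun t ht => (h' t ht).2, fun x hx => ?_, fun x hx => ?_⟩
    · exact (hac.add hφc).mul
        (((hf.continuous_b.div hac ha0).sub continuousOn_const).add hφ')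
    · rw [hnorm x hx, (h' _ ⟨x, hx, rfl⟩).1]
    · rw [hlap x hx, (h' _ ⟨x, hx, rfl⟩).2]

end Randers

theorem mainTheorem3 {n : ℕ} {N : Type*} [TopologicalSpace N]
    [ChartedSpace (EuclideanSpace ℝ (Fin n)) N] [IsManifold (𝓡 n) ∞ N]
    (h : Randers.RiemMetric n N)
    (W : (x : N) → TangentSpace (𝓡 n) x)
    (hW : ContMDiff (𝓡 n) (𝓡 n).tangent ∞ (fun x : N => (⟨x, W x⟩ : TangentBundle (𝓡 n) N)))
    (hW1 : ∀ x : N, h.inner x (W x) (W x) < 1)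
    (k₀ : ℝ) (hhom : Randers.IsHomothetic h W k₀)
    (f : N → ℝ) (a b : ℝ → ℝ)
    (hf : Randers.IsIsoparametricWith (Randers.riemNorm h) (Randers.riemVol h) f a b) :
    (Randers.IsIsoparametric (Randers.randersMetric h W)
        (Randers.volBH (Randers.randersMetric h W)) f ↔
      ∃ φ : ℝ → ℝ, ContDiffOn ℝ ∞ φ (Randers.regularValues n f) ∧
        ∀ x ∈ Randers.regularSet n f, Randers.diff f x (W x) = φ (f x)) ∧
    (∀ φ : ℝ → ℝ, ContDiffOn ℝ ∞ φ (Randers.regularValues n f) →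
      (∀ x ∈ Randers.regularSet n f, Randers.diff f x (W x) = φ (f x)) →
      ∀ a' b' : ℝ → ℝ,
        Randers.IsIsoparametricWith (Randers.randersMetric h W)
            (Randers.volBH (Randers.randersMetric h W)) f a' b' ↔
          ∀ t ∈ Randers.regularValues n f,
            a' t = a t + φ t ∧
            b' t = (a t + φ t) * (b t / a t - 2 * n * k₀ + deriv φ t)) := by
  refine ⟨⟨?_, ?_⟩, fun φ hφ hWf a' b' =>
    Randers.isIsoparametricWith_randersMetric h hW hW1 hhom hf hφ hWf a' b'⟩
  · rintro ⟨a', b', h'⟩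
    -- Forced by F(∇f) = ‖∇ʰf‖ + df(W); the Laplacian equation plays no role in this direction.
    refine ⟨fun t => a' t - a t, h'.smooth_a.sub hf.smooth_a, fun x hx => ?_⟩
    change _ = a' (f x) - a (f x)
    rw [← h'.norm_gradient x hx, Randers.randersMetric_gradient_eq h (hW1 x) hx,
      hf.norm_gradient x hx]
    ring
  · rintro ⟨φ, hφ, hWf⟩
    exact ⟨_, _, (Randers.isIsoparametricWith_randersMetric h hW hW1 hhom hf hφ hWf
      (fun t => a t + φ t) (fun t => (a t + φ t) * (b t / a t - 2 * n * k₀ + deriv φ t))).2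
      fun t _ => ⟨rfl, rfl⟩⟩
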